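/- **Knowledge bases.** Individuals are $\mathsf{N_I^+}=\mathsf{N_I}\cup\mathsf{N_A}\cup\mathsf{N_T}$ (ordinary individuals, argument identifiers $\mathsf{N_A}=\{a_1,a_2,\dots\}$, textual arguments); concept names are $\mathsf{N_C^+}=\mathsf{N_C}\cup\{\mathtt{Arg},\mathtt{TArg}\}$ and role names are $\mathsf{N_R^+}=\mathsf{N_R}\cup\mathsf{N_F}\cup\{\mathtt{att},\mathtt{sup},\mathtt{textOf}\}$. A *fuzzy argumentative ABox* (FABox) is a finite set of assertions $\langle A(a),v\rangle$, $\langle r(a,b),v\rangle$ with $v\in[0,1]$ if the predicate is $\mathtt{Arg}$, $\mathtt{att}$ or $\mathtt{sup}$ and $v=1$ otherwise, where $\mathtt{Arg}$, $\mathtt{TArg}$ apply to elements of $\mathsf{N_A}$, $\mathsf{N_T}$ respectively, $\mathtt{att},\mathtt{sup}$ to $\mathsf{N_A}\times\mathsf{N_A}$, $\mathtt{textOf}$ to $\mathsf{N_A}\times\mathsf{N_T}$, and features in $\mathsf{N_F}$ to $\mathsf{N_A}\times\mathsf{N_I}$. It is *consistent* if the degree of each $\mathtt{Arg}(a)$ is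 unique; each pair $(a,b)$ carries at most one assertion with predicate in $\{\mathtt{att},\mathtt{sup}\}$, and then $\mathtt{Arg}(a),\mathtt{Arg}(b)$ are asserted; and the asserted pairs of $\mathtt{textOf}$ form a bijection from the asserted instances of $\mathtt{Arg}$ onto those of $\mathtt{TArg}$. A *fuzzy argumentative KB* is a pair $\mathcal K=\langle\mathcal T,\mathcal A\rangle$ of a DL-Lite$_{\mathcal R}$ TBox $\mathcal T$ (a finite set of inclusions $B\sqsubseteq B'$, $B\sqsubseteq\neg B'$, $Q\sqsubseteq Q'$, $Q\sqsubseteq\neg Q'$ with $B::=A\mid\exists Q$ and $Q::=r\mid r^-$) in which the built-in names $\mathtt{Arg},\mathtt{TArg},\mathtt{att},\mathtt{sup},\mathtt{textOf}$ do not occur in right-hand sides, and a consistent FABox $\mathcal A$. **Semantics.** A fuzzy interpretation $\mathcal I$ has a non-empty domain $\Delta$, interprets distinct individuals by distinct elements of $\Delta$, and interprets concept and role names by functions $\Delta\to[0,1]$ and $\Delta\times\Delta\to[0,1]$, with $(\exists Q)(d)=\sup_{e\in\Delta}Q(d,e)$, $r^-(d,e)=r(e,d)$ and $\neg$ read as $1-\cdot$.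 It is a model of $\mathcal K$ if every inclusion $G\sqsubseteq H$ of $\mathcal T$ satisfies $G^{\mathcal I}\le H^{\mathcal I}$ pointwise on $\Delta$ and every assertion $\langle\varphi,v\rangle\in\mathcal A$ satisfies $\varphi^{\mathcal I}\ge v$. $\mathcal K$ is consistent if it has a model. $\mathcal I_{\mathcal A}$ is the interpretation in which every individual denotes itself and each fact has its degree in $\mathcal A$ ($0$ if it is not asserted). **Queries.** A fuzzy conjunctive query $q(\vec x)=\exists\vec y\,\varphi(\vec x,\vec y)$ has as $\varphi$ a finite conjunction of atoms $A(s)$, $r(s,s')$ over variables and individuals, and its answer variables $\vec x$ occur in $\varphi$; a union (UFCQ) is a finite disjunction of such queries of the same arity. (The answer tuple may also repeat variables or contain individuals.) The degree $(q(\vec t))^{\mathcal I}$ reads $\wedge,\vee,\exists$ as $\min,\max,\sup$. Put $$\mathit{fcert}(q,\mathcal K)=\{\langle\vec t,\alpha\rangle\mid \alpha=\inf_{\mathcal I\models\mathcal K}(q(\vec t))^{\mathcal I},\ \alpha>0\},\qquad \mathit{fans}(q,\mathcal A)=\{\langle\vec t,\alpha\rangle\mid \alpha=(q(\vec t))^{\mathcal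 I_{\mathcal A}},\ \alpha>0\},$$ where $\vec t$ ranges over tuples of individuals. **Reformulation.** $\mathsf{ref}(q,\mathcal T)$ is the output of the standard DL-Lite$_{\mathcal R}$ algorithm PerfectRef: the finite union of all conjunctive queries obtained from a disjunct of $q$ by repeatedly applying the following two steps. (a) Replace an atom using a positive inclusion of $\mathcal T$ from right to left: with $B\sqsubseteq A$ replace $A(s)$ by $B(s)$; with $B\sqsubseteq\exists Q$ replace $Q(s,y)$ by $B(s)$, provided that $y$ is a variable that is not an answer variable and occurs only once in the query body; with $Q\sqsubseteq Q'$ replace $Q'(s,s')$ by $Q(s,s')$. Here $r^-(s,s')$ stands for $r(s',s)$ and $(\exists Q)(s)$ for $Q(s,z)$ with a fresh variable $z$. (b) Apply a most general unifier of two atoms of the body to the whole query. **Proposition.** Let $\mathcal K=\langle\mathcal T,\mathcal A\rangle$ be a consistent fuzzy argumentative KB and $q(\vec x)$ a (union of) fuzzy conjunctive queries. Then $$\mathit{fcert}(q(\vec x),\mathcal K)=\mathit{fans}(\mathsf{ref}(q(\vec x),\mathcal T),\mathcal A).$$ In particular, answering UFCQs is first-order rewritable: the finite query $\mathsf{ref}(q,\mathcal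 T)$ does not depend on $\mathcal A$. -/

import Mathlib

universe u

namespace FuzzyArg

/-- The name sets a knowledge base is built from: ordinary individuals `N_I`, textual arguments
`N_T`, concept names `N_C`, role names `N_R` and argument features `N_F`. The argument identifiers
`N_A = {a₁, a₂, …}` are the natural numbers. -/
structure Signature : Type (u + 1) where
  NI : Type u
  NT : Type u
  NC : Type u
  NR : Type u
  NF : Type u

/-- Augmented individuals: `N_I ∪ N_A ∪ N_T`. -/
inductive Ind (S : Signature.{u}) : Type u
  | ind (a : S.NI)
  | arg (i : ℕ)
  | text (w : S.NT)

/-- Augmented concept names: `N_C ∪ {Arg, TArg}`. -/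
inductive CName (S : Signature.{u}) : Type u
  | name (A : S.NC)
  | Arg
  | TArg

/-- Augmented role names: `N_R ∪ N_F ∪ {att, sup, textOf}`. -/
inductive RName (S : Signature.{u}) : Type u
  | name (r : S.NR)
  | feature (f : S.NF)
  | att
  | sup
  | textOf

def CName.BuiltIn {S : Signature.{u}} : CName S → Prop
  | .name _ => False
  | .Arg => True
  | .TArg => True

def RName.BuiltIn {S : Signature.{u}} : RName S → Prop
  | .name _ => False
  | .feature _ => False
  | .att => True
  | .sup => True
  | .textOf => True

/-! ### DL-Lite_R TBoxes -/

/-- Basic roles `Q ::= r | r⁻`. -/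
inductive BRole (S : Signature.{u}) : Type u
  | name (r : RName S)
  | inv (r : RName S)

/-- Basic concepts `B ::= A | ∃Q`. -/
inductive BConcept (S : Signature.{u}) : Type u
  | name (A : CName S)
  | ex (Q : BRole S)

/-- DL-Lite_R inclusions `B ⊑ B'`, `B ⊑ ¬B'`, `Q ⊑ Q'`, `Q ⊑ ¬Q'`. -/
inductive Inclusion (S : Signature.{u}) : Type u
  | concept (B B' : BConcept S)
  | conceptNeg (B B' : BConcept S)
  | role (Q Q' : BRole S)
  | roleNeg (Q Q' : BRole S)

abbrev TBox (S : Signature.{u}) := Finset (Inclusion S)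

def BRole.BuiltIn {S : Signature.{u}} : BRole S → Prop
  | .name r => r.BuiltIn
  | .inv r => r.BuiltIn

def BConcept.BuiltIn {S : Signature.{u}} : BConcept S → Prop
  | .name A => A.BuiltIn
  | .ex Q => Q.BuiltIn

/-- A built-in name occurs in the right-hand side of the inclusion. -/
def Inclusion.RhsBuiltIn {S : Signature.{u}} : Inclusion S → Prop
  | .concept _ B' => B'.BuiltIn
  | .conceptNeg _ B' => B'.BuiltIn
  | .role _ Q' => Q'.BuiltIn
  | .roleNeg _ Q' => Q'.BuiltIn

/-! ### Fuzzy argumentative ABoxes and knowledge bases -/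

/-- Fuzzy assertions `⟨A(a), v⟩` and `⟨r(a, b), v⟩` with `v ∈ [0,1]`. -/
inductive FAssertion (S : Signature.{u}) : Type u
  | concept (A : CName S) (a : Ind S) (v : unitInterval)
  | role (r : RName S) (a b : Ind S) (v : unitInterval)

/-- An assertion is admissible if the built-in concepts and roles and the argument features respect
their domains (`Arg ⊆ N_A`, `TArg ⊆ N_T`, `att, sup ⊆ N_A × N_A`, `textOf ⊆ N_A × N_T`,
features `⊆ N_A × N_I`), and its degree is `1` unless it is about `Arg`, `att` or `sup`. -/
def FAssertion.Admissible {S : Signature.{u}} : FAssertion S → Prop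
  | .concept (.name _) _ v => v = 1
  | .concept .Arg a _ => ∃ i, a = .arg i
  | .concept .TArg a v => (∃ w, a = .text w) ∧ v = 1
  | .role (.name _) _ _ v => v = 1
  | .role (.feature _) a b v => (∃ i, a = .arg i) ∧ (∃ c, b = .ind c) ∧ v = 1
  | .role .att a b _ => (∃ i, a = .arg i) ∧ (∃ j, b = .arg j)
  | .role .sup a b _ => (∃ i, a = .arg i) ∧ (∃ j, b = .arg j)
  | .role .textOf a b v => (∃ i, a = .arg i) ∧ (∃ w, b = .text w) ∧ v = 1

/-- A fuzzy argumentative ABox: a finite set of admissible fuzzy assertions. -/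
structure FABox (S : Signature.{u}) where
  assertions : Finset (FAssertion S)
  admissible : ∀ φ ∈ assertions, φ.Admissible

/-- `A(a)` is asserted with some degree. -/
def FABox.HasConcept {S : Signature.{u}} (A : FABox S) (C : CName S) (a : Ind S) : Prop :=
  ∃ v, FAssertion.concept C a v ∈ A.assertions

/-- `r(a, b)` is asserted with some degree. -/
def FABox.HasRole {S : Signature.{u}} (A : FABox S) (r : RName S) (a b : Ind S) : Prop :=
  ∃ v, FAssertion.role r a b v ∈ A.assertions

/-- Consistency of a fuzzy argumentative ABox (the condition under which it subsumes a quantitative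
bipolar argumentation framework). -/
structure FABox.Consistent {S : Signature.{u}} (A : FABox S) : Prop where
  arg_unique : ∀ a u v, FAssertion.concept .Arg a u ∈ A.assertions →
    FAssertion.concept .Arg a v ∈ A.assertions → u = v
  att_sup : ∀ r s a b u v, (r = RName.att ∨ r = RName.sup) → (s = RName.att ∨ s = RName.sup) →
    FAssertion.role r a b u ∈ A.assertions → FAssertion.role s a b v ∈ A.assertions →
    r = s ∧ u = v ∧ A.HasConcept .Arg a ∧ A.HasConcept .Arg b
  textOf_dom : ∀ a b, A.HasRole .textOf a b → A.HasConcept .Arg a ∧ A.HasConcept .TArg b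
  textOf_right : ∀ a, A.HasConcept .Arg a → ∃! b, A.HasRole .textOf a b
  textOf_left : ∀ b, A.HasConcept .TArg b → ∃! a, A.HasRole .textOf a b

/-- A fuzzy argumentative knowledge base: a DL-Lite_R TBox in which built-in names do not occur in
the right-hand side of inclusions, and a consistent fuzzy argumentative ABox. -/
structure FAKB (S : Signature.{u}) where
  tbox : TBox S
  abox : FABox S
  rhs_not_builtIn : ∀ ι ∈ tbox, ¬ ι.RhsBuiltIn
  abox_consistent : abox.Consistent

/-! ### Fuzzy interpretations -/

/-- Fuzzy interpretations, with the unique names assumption. -/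
structure FInterp (S : Signature.{u}) : Type (u + 1) where
  Dom : Type u
  nonempty : Nonempty Dom
  ind : Ind S → Dom
  ind_injective : Function.Injective ind
  concept : CName S → Dom → unitInterval
  role : RName S → Dom → Dom → unitInterval

def FInterp.brole {S : Signature.{u}} (I : FInterp S) : BRole S → I.Dom → I.Dom → unitInterval
  | .name r, d, e => I.role r d e
  | .inv r, d, e => I.role r e d

noncomputable def FInterp.bconcept {S : Signature.{u}} (I : FInterp S) :
    BConcept S → I.Dom → unitInterval
  | .name A, d => I.concept A d
  | .ex Q, d => ⨆ e, I.brole Q d e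

/-- `I` satisfies `G ⊑ H` if `H^I ≥ G^I` pointwise; negation is `1 - x` (`unitInterval.symm`). -/
def FInterp.SatInclusion {S : Signature.{u}} (I : FInterp S) : Inclusion S → Prop
  | .concept B B' => ∀ d, I.bconcept B d ≤ I.bconcept B' d
  | .conceptNeg B B' => ∀ d, I.bconcept B d ≤ unitInterval.symm (I.bconcept B' d)
  | .role Q Q' => ∀ d e, I.brole Q d e ≤ I.brole Q' d e
  | .roleNeg Q Q' => ∀ d e, I.brole Q d e ≤ unitInterval.symm (I.brole Q' d e)

def FInterp.SatAssertion {S : Signature.{u}} (I : FInterp S) : FAssertion S → Prop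
  | .concept A a v => v ≤ I.concept A (I.ind a)
  | .role r a b v => v ≤ I.role r (I.ind a) (I.ind b)

def FInterp.IsModel {S : Signature.{u}} (I : FInterp S) (K : FAKB S) : Prop :=
  (∀ ι ∈ K.tbox, I.SatInclusion ι) ∧ ∀ φ ∈ K.abox.assertions, I.SatAssertion φ

/-- A knowledge base is consistent if it has a fuzzy model. -/
def FAKB.Consistent {S : Signature.{u}} (K : FAKB S) : Prop :=
  ∃ I : FInterp S, I.IsModel K

/-- The interpretation `I_A` of a fuzzy ABox read as a database: every individual denotes itself, and
the degree of a fact is its degree in the ABox, `0` if the fact is not asserted. -/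
noncomputable def FABox.interp {S : Signature.{u}} (A : FABox S) : FInterp S where
  Dom := Ind S
  nonempty := ⟨.arg 0⟩
  ind := id
  ind_injective := Function.injective_id
  concept C a := sSup {v | FAssertion.concept C a v ∈ A.assertions}
  role r a b := sSup {v | FAssertion.role r a b v ∈ A.assertions}

/-! ### Fuzzy conjunctive queries -/

/-- Terms: variables (numbered) and individuals. -/
inductive Term (S : Signature.{u}) : Type u
  | var (x : ℕ)
  | const (a : Ind S)

inductive Atom (S : Signature.{u}) : Type u
  | concept (A : CName S) (t : Term S)
  | role (r : RName S) (t t' : Term S)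

/-- A conjunctive query `q(h₁, …, hₙ) ← body`: the variables of the head are the free variables,
all others are existentially quantified. A query `∃ y⃗. φ(x⃗, y⃗)` has the tuple `x⃗` as its head;
unifying atoms during rewriting may identify variables of the head or replace them by individuals. -/
@[ext] structure CQ (S : Signature.{u}) (n : ℕ) where
  head : Fin n → Term S
  body : Finset (Atom S)

/-- Unions of conjunctive queries. -/
abbrev UCQ (S : Signature.{u}) (n : ℕ) := Finset (CQ S n)

/-- The variables of a term, of an atom (with multiplicity), of the head and of the body. -/
def Term.vars {S : Signature.{u}} : Term S → Multiset ℕ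
  | .var x => {x}
  | .const _ => 0

def Atom.vars {S : Signature.{u}} : Atom S → Multiset ℕ
  | .concept _ t => t.vars
  | .role _ t t' => t.vars + t'.vars

def CQ.headVars {S : Signature.{u}} {n : ℕ} (q : CQ S n) : Multiset ℕ := ∑ i, (q.head i).vars

def CQ.bodyVars {S : Signature.{u}} {n : ℕ} (q : CQ S n) : Multiset ℕ := ∑ g ∈ q.body, g.vars

/-- The variables of the head occur in the body, that is, they are free variables of the formula. -/
def CQ.Safe {S : Signature.{u}} {n : ℕ} (q : CQ S n) : Prop := ∀ x ∈ q.headVars, x ∈ q.bodyVars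

def Term.eval {S : Signature.{u}} (I : FInterp S) (σ : ℕ → I.Dom) : Term S → I.Dom
  | .var x => σ x
  | .const a => I.ind a

def Atom.degree {S : Signature.{u}} (I : FInterp S) (σ : ℕ → I.Dom) : Atom S → unitInterval
  | .concept A t => I.concept A (t.eval I σ)
  | .role r t t' => I.role r (t.eval I σ) (t'.eval I σ)

/-- The degree `(q(t⃗))^I`: existential quantification is supremum, conjunction is minimum. -/
noncomputable def CQ.degree {S : Signature.{u}} {n : ℕ} (q : CQ S n) (I : FInterp S)
    (t : Fin n → Ind S) : unitInterval :=
  ⨆ (σ : ℕ → I.Dom) (_ : ∀ i, (q.head i).eval I σ = I.ind (t i)),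
    q.body.inf fun g => g.degree I σ

/-- The degree of a union: disjunction is maximum. -/
noncomputable def UCQ.degree {S : Signature.{u}} {n : ℕ} (Q : UCQ S n) (I : FInterp S)
    (t : Fin n → Ind S) : unitInterval :=
  Q.sup fun q => q.degree I t

/-- Fuzzy certain answers. -/
noncomputable def fcert {S : Signature.{u}} {n : ℕ} (Q : UCQ S n) (K : FAKB S) :
    Set ((Fin n → Ind S) × unitInterval) :=
  {p | p.2 = (⨅ (I : FInterp S) (_ : I.IsModel K), UCQ.degree Q I p.1) ∧ 0 < p.2}

/-- Answers over a fuzzy ABox. -/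
def ans {S : Signature.{u}} {n : ℕ} (Q : UCQ S n) (A : FABox S) : Set (Fin n → Ind S) :=
  {t | 0 < UCQ.degree Q A.interp t}

/-- Fuzzy answers over a fuzzy ABox. -/
noncomputable def fans {S : Signature.{u}} {n : ℕ} (Q : UCQ S n) (A : FABox S) :
    Set ((Fin n → Ind S) × unitInterval) :=
  {p | p.1 ∈ ans Q A ∧ p.2 = UCQ.degree Q A.interp p.1}

/-! ### The perfect reformulation of DL-Lite_R (the algorithm PerfectRef) -/

/-- A term is unbound in `q` if it is a variable that is neither distinguished (in the head) nor
shared (occurring at least twice in the body). -/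
def CQ.Unbound {S : Signature.{u}} {n : ℕ} (q : CQ S n) (t : Term S) : Prop :=
  ∃ x, t = .var x ∧ x ∉ q.headVars ∧ q.bodyVars.count x = 1

/-- The least variable that does not occur in `q`. -/
noncomputable def CQ.fresh {S : Signature.{u}} {n : ℕ} (q : CQ S n) : ℕ :=
  sInf {x | x ∉ q.headVars + q.bodyVars}

/-- The atom `Q(t, t')`. -/
def BRole.atom {S : Signature.{u}} : BRole S → Term S → Term S → Atom S
  | .name r, t, t' => .role r t t'
  | .inv r, t, t' => .role r t' t

/-- The atom for `B(t)`: `A(t)`, or `Q(t, y)` with the variable `y` if `B = ∃Q`. -/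
def BConcept.atom {S : Signature.{u}} : BConcept S → Term S → ℕ → Atom S
  | .name A, t, _ => .concept A t
  | .ex Q, t, y => Q.atom t (.var y)

/-- `g'` results from applying a positive inclusion of `T`, from right to left, to the atom `g`
of `q`. -/
inductive AtomRewrite {S : Signature.{u}} {n : ℕ} (T : TBox S) (q : CQ S n) :
    Atom S → Atom S → Prop
  | name (B : BConcept S) (A : CName S) (t : Term S) :
      Inclusion.concept B (.name A) ∈ T →
      AtomRewrite T q (.concept A t) (B.atom t q.fresh)
  | ex (B : BConcept S) (Q : BRole S) (t t' : Term S) :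
      Inclusion.concept B (.ex Q) ∈ T → q.Unbound t' →
      AtomRewrite T q (Q.atom t t') (B.atom t q.fresh)
  | role (Q Q' : BRole S) (t t' : Term S) :
      Inclusion.role Q Q' ∈ T →
      AtomRewrite T q (Q'.atom t t') (Q.atom t t')

def Term.subst {S : Signature.{u}} (θ : ℕ → Term S) : Term S → Term S
  | .var x => θ x
  | .const a => .const a

def Atom.subst {S : Signature.{u}} (θ : ℕ → Term S) : Atom S → Atom S
  | .concept A t => .concept A (t.subst θ)
  | .role r t t' => .role r (t.subst θ) (t'.subst θ)

open scoped Classical in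
/-- Most general unifier of two terms. -/
noncomputable def Term.mgu {S : Signature.{u}} : Term S → Term S → Option (ℕ → Term S)
  | .var x, t => some (Function.update Term.var x t)
  | .const a, .var x => some (Function.update Term.var x (.const a))
  | .const a, .const b => if a = b then some Term.var else none

open scoped Classical in
/-- Most general unifier of two atoms. -/
noncomputable def Atom.mgu {S : Signature.{u}} : Atom S → Atom S → Option (ℕ → Term S)
  | .concept A t, .concept A' u => if A = A' then t.mgu u else none
  | .role r t t', .role r' u u' =>
      if r = r' then
        (t.mgu u).bind fun θ =>
          ((t'.subst θ).mgu (u'.subst θ)).map fun η x => (θ x).subst η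
      else none
  | _, _ => none

open scoped Classical in
/-- Replace the atom `g` of the body by `g'`. -/
noncomputable def CQ.replace {S : Signature.{u}} {n : ℕ} (q : CQ S n) (g g' : Atom S) : CQ S n where
  head := q.head
  body := insert g' (q.body.erase g)

open scoped Classical in
noncomputable def CQ.subst {S : Signature.{u}} {n : ℕ} (θ : ℕ → Term S) (q : CQ S n) : CQ S n where
  head i := (q.head i).subst θ
  body := q.body.image (Atom.subst θ)

/-- One step of the reformulation: rewrite an atom with an inclusion, or unify two atoms. -/
inductive Step {S : Signature.{u}} {n : ℕ} (T : TBox S) : CQ S n → CQ S n → Prop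
  | rewrite (q : CQ S n) (g g' : Atom S) :
      g ∈ q.body → AtomRewrite T q g g' → Step T q (q.replace g g')
  | reduce (q : CQ S n) (g₁ g₂ : Atom S) (θ : ℕ → Term S) :
      g₁ ∈ q.body → g₂ ∈ q.body → g₁.mgu g₂ = some θ → Step T q (q.subst θ)

/-! The reformulation is a finite union: up to the (boundedly many) variable names, only finitely
many queries can be reached. -/

/-- All symbols of the atom belong to the given sets. -/
def Atom.Over {S : Signature.{u}} (CN : Set (CName S)) (RN : Set (RName S)) (F : Set (Term S)) :
    Atom S → Prop
  | .concept A t => A ∈ CN ∧ t ∈ F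
  | .role r t t' => r ∈ RN ∧ t ∈ F ∧ t' ∈ F

theorem Atom.finite_over {S : Signature.{u}} {CN : Set (CName S)} {RN : Set (RName S)}
    {F : Set (Term S)} (hC : CN.Finite) (hR : RN.Finite) (hF : F.Finite) :
    {g : Atom S | g.Over CN RN F}.Finite := by
  refine (((hC.prod hF).image fun p => Atom.concept p.1 p.2).union
    ((hR.prod (hF.prod hF)).image fun p => Atom.role p.1 p.2.1 p.2.2)).subset ?_
  rintro (⟨A, t⟩ | ⟨r, t, t'⟩) h
  · exact Or.inl ⟨(A, t), ⟨h.1, h.2⟩, rfl⟩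
  · exact Or.inr ⟨(r, t, t'), ⟨h.1, h.2.1, h.2.2⟩, rfl⟩

theorem CQ.finite_over {S : Signature.{u}} {n : ℕ} {CN : Set (CName S)} {RN : Set (RName S)}
    {F : Set (Term S)} (hC : CN.Finite) (hR : RN.Finite) (hF : F.Finite) :
    {q : CQ S n | (∀ i, q.head i ∈ F) ∧ ∀ g ∈ q.body, g.Over CN RN F}.Finite := by
  have hU := Atom.finite_over hC hR hF
  refine (((Set.Finite.pi' fun _ : Fin n => hF).prod hU.toFinset.powerset.finite_toSet).image
    fun p => CQ.mk p.1 p.2).subset ?_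
  rintro ⟨h, b⟩ ⟨hh, hb⟩
  refine ⟨(h, b), ⟨hh, ?_⟩, rfl⟩
  simp only [Finset.mem_coe, Finset.mem_powerset]
  intro g hg
  simpa using hb g hg

theorem Term.mgu_mem {S : Signature.{u}} {F : Set (Term S)} {s t : Term S} (hs : s ∈ F)
    (ht : t ∈ F) {θ : ℕ → Term S} (h : s.mgu t = some θ) {w : Term S} (hw : w ∈ F) :
    w.subst θ ∈ F := by
  rcases w with y | c
  swap
  · exact hw
  rcases s with x | a
  · simp only [Term.mgu, Option.some.injEq] at h
    subst h
    by_cases hy : y = x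
    · subst hy; simpa [Term.subst] using ht
    · simpa [Term.subst, Function.update_of_ne hy] using hw
  · rcases t with x | b
    · simp only [Term.mgu, Option.some.injEq] at h
      subst h
      by_cases hy : y = x
      · subst hy; simpa [Term.subst] using hs
      · simpa [Term.subst, Function.update_of_ne hy] using hw
    · simp only [Term.mgu, Option.ite_none_right_eq_some, Option.some.injEq] at h
      rw [← h.2]; exact hw

theorem Term.subst_subst {S : Signature.{u}} (θ η : ℕ → Term S) (w : Term S) :
    w.subst (fun x => (θ x).subst η) = (w.subst θ).subst η := by
  cases w <;> rfl

theorem Atom.mgu_mem {S : Signature.{u}} {CN : Set (CName S)} {RN : Set (RName S)}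
    {F : Set (Term S)} {g g' : Atom S} (hg : g.Over CN RN F) (hg' : g'.Over CN RN F)
    {θ : ℕ → Term S} (h : g.mgu g' = some θ) {w : Term S} (hw : w ∈ F) : w.subst θ ∈ F := by
  rcases g with ⟨A, t⟩ | ⟨r, t, t'⟩ <;> rcases g' with ⟨A', v⟩ | ⟨r', v, v'⟩
  · simp only [Atom.mgu, Option.ite_none_right_eq_some] at h
    exact Term.mgu_mem hg.2 hg'.2 h.2 hw
  · simp [Atom.mgu] at h
  · simp [Atom.mgu] at h
  · simp only [Atom.mgu, Option.ite_none_right_eq_some, Option.bind_eq_some_iff,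
      Option.map_eq_some_iff] at h
    obtain ⟨-, θ₁, h₁, η, h₂, rfl⟩ := h
    rw [Term.subst_subst]
    have key := fun {w : Term S} (hw : w ∈ F) => Term.mgu_mem hg.2.1 hg'.2.1 h₁ hw
    exact Term.mgu_mem (key hg.2.2) (key hg'.2.2) h₂ (key hw)

theorem Term.card_vars {S : Signature.{u}} (t : Term S) : t.vars.card ≤ 1 := by
  cases t <;> simp [Term.vars]

theorem CQ.fresh_le {S : Signature.{u}} {n : ℕ} (q : CQ S n) :
    q.fresh ≤ n + 2 * q.body.card := by
  classical
  have h1 : q.headVars.card ≤ n := by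
    rw [CQ.headVars, Multiset.card_sum]
    exact (Finset.sum_le_sum fun i _ => Term.card_vars _).trans (by simp)
  have h2 : q.bodyVars.card ≤ 2 * q.body.card := by
    rw [CQ.bodyVars, Multiset.card_sum]
    refine (Finset.sum_le_sum (g := fun _ => 2) fun g _ => ?_).trans (by simp [mul_comm])
    rcases g with ⟨A, t⟩ | ⟨r, t, t'⟩
    · exact (Term.card_vars t).trans (by norm_num)
    · have := Term.card_vars t
      have := Term.card_vars t'
      simp only [Atom.vars, Multiset.card_add]
      omega
  by_contra hlt
  push Not at hlt
  have hsub : Finset.range (n + 2 * q.body.card + 1) ⊆ (q.headVars + q.bodyVars).toFinset := by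
    intro x hx
    have hx' : x < q.fresh := by
      have := Finset.mem_range.1 hx
      omega
    have := Nat.notMem_of_lt_sInf hx'
    rw [Multiset.mem_toFinset]
    by_contra hc
    exact this hc
  have h3 := Finset.card_le_card hsub
  have h4 := Multiset.toFinset_card_le (q.headVars + q.bodyVars)
  rw [Multiset.card_add] at h4
  rw [Finset.card_range] at h3
  omega

def BRole.rname {S : Signature.{u}} : BRole S → RName S
  | .name r => r
  | .inv r => r

theorem BRole.over_atom {S : Signature.{u}} {CN : Set (CName S)} {RN : Set (RName S)}
    {F : Set (Term S)} (Q : BRole S) (t t' : Term S) :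
    (Q.atom t t').Over CN RN F ↔ Q.rname ∈ RN ∧ t ∈ F ∧ t' ∈ F := by
  cases Q <;> simp [BRole.atom, BRole.rname, Atom.Over, and_comm]

theorem finite_reachable {S : Signature.{u}} {n : ℕ} (T : TBox S) (q : CQ S n) :
    {q' | Relation.ReflTransGen (Step T) q q'}.Finite := by
  classical
  set CN : Set (CName S) := (⋃ g ∈ q.body, {A | ∃ t, g = .concept A t}) ∪
    ⋃ ι ∈ T, {A | ∃ B', ι = .concept (.name A) B'} with hCN
  set RN : Set (RName S) := (⋃ g ∈ q.body, {r | ∃ t t', g = .role r t t'}) ∪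
    ⋃ ι ∈ T, {r | (∃ Q B', ι = .concept (.ex Q) B' ∧ Q.rname = r) ∨
      ∃ Q Q', ι = .role Q Q' ∧ Q.rname = r} with hRN
  set F : Set (Term S) := (Set.range q.head ∪
    ⋃ g ∈ q.body, {t | (∃ A, g = .concept A t) ∨ (∃ r t', g = .role r t t') ∨
      ∃ r t', g = .role r t' t}) ∪ Term.var '' Set.Iic (n + 2 * q.body.card) with hF
  have fC : CN.Finite := by
    refine (q.body.finite_toSet.biUnion fun g _ => Set.Subsingleton.finite ?_).union
      (T.finite_toSet.biUnion fun ι _ => Set.Subsingleton.finite ?_)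
    · rintro A ⟨t, rfl⟩ A' ⟨t', h⟩
      cases h; rfl
    · rintro A ⟨t, rfl⟩ A' ⟨t', h⟩
      cases h; rfl
  have fR : RN.Finite := by
    refine (q.body.finite_toSet.biUnion fun g _ => Set.Subsingleton.finite ?_).union
      (T.finite_toSet.biUnion fun ι _ => Set.Subsingleton.finite ?_)
    · rintro A ⟨t, t', rfl⟩ A' ⟨s, s', h⟩
      cases h; rfl
    · rintro A (⟨Q, B, rfl, rfl⟩ | ⟨Q, B, rfl, rfl⟩) A' (⟨Q', B', h, rfl⟩ | ⟨Q', B', h, rfl⟩) <;>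
        cases h <;> rfl
  have fF : F.Finite := by
    refine ((Set.finite_range _).union (q.body.finite_toSet.biUnion fun g _ => ?_)).union
      ((Set.finite_Iic _).image _)
    refine (Set.Subsingleton.finite ?_).union
      ((Set.Subsingleton.finite ?_).union (Set.Subsingleton.finite ?_))
    · rintro t ⟨A, rfl⟩ t' ⟨A', h⟩
      cases h; rfl
    · rintro t ⟨r, s, rfl⟩ t' ⟨r', s', h⟩
      cases h; rfl
    · rintro t ⟨r, s, rfl⟩ t' ⟨r', s', h⟩
      cases h; rfl
  suffices H : ∀ q', Relation.ReflTransGen (Step T) q q' →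
      ((∀ i, q'.head i ∈ F) ∧ ∀ g ∈ q'.body, g.Over CN RN F) ∧ q'.body.card ≤ q.body.card from
    (CQ.finite_over fC fR fF).subset fun q' h => (H q' h).1
  intro q' h
  induction h with
  | refl =>
    refine ⟨⟨fun i => Or.inl (Or.inl ⟨i, rfl⟩), fun g hg => ?_⟩, le_rfl⟩
    rcases g with ⟨A, t⟩ | ⟨r, t, t'⟩
    · exact ⟨Or.inl (Set.mem_biUnion hg ⟨t, rfl⟩),
        Or.inl (Or.inr (Set.mem_biUnion hg (Or.inl ⟨A, rfl⟩)))⟩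
    · exact ⟨Or.inl (Set.mem_biUnion hg ⟨t, t', rfl⟩),
        Or.inl (Or.inr (Set.mem_biUnion hg (Or.inr (Or.inl ⟨r, t', rfl⟩)))),
        Or.inl (Or.inr (Set.mem_biUnion hg (Or.inr (Or.inr ⟨r, t, rfl⟩))))⟩
  | @tail p _ _ hstep ih =>
    obtain ⟨⟨ih1, ih2⟩, ih3⟩ := ih
    cases hstep with
    | rewrite g g' hg hr =>
      have hfresh : Term.var p.fresh ∈ F :=
        Or.inr ⟨p.fresh, p.fresh_le.trans (by simpa using ih3), rfl⟩
      have hBatom : ∀ (B B' : BConcept S) (t : Term S), Inclusion.concept B B' ∈ T → t ∈ F →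
          (B.atom t p.fresh).Over CN RN F := by
        rintro (A | Q) B' t hT ht
        · exact ⟨Or.inr (Set.mem_biUnion hT ⟨B', rfl⟩), ht⟩
        · exact (BRole.over_atom _ _ _).2
            ⟨Or.inr (Set.mem_biUnion hT (Or.inl ⟨Q, B', rfl, rfl⟩)), ht, hfresh⟩
      have hg' : g'.Over CN RN F := by
        have h0 := ih2 g hg
        cases hr with
        | name B A t hT => exact hBatom _ _ _ hT h0.2
        | ex B Q t t' hT _ => exact hBatom _ _ _ hT ((BRole.over_atom _ _ _).1 h0).2.1
        | role Q Q' t t' hT =>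
          have h1 := (BRole.over_atom _ _ _).1 h0
          exact (BRole.over_atom _ _ _).2
            ⟨Or.inr (Set.mem_biUnion hT (Or.inr ⟨Q, Q', rfl, rfl⟩)), h1.2⟩
      refine ⟨⟨ih1, fun a ha => ?_⟩, ?_⟩
      · rcases Finset.mem_insert.1 ha with rfl | ha
        · exact hg'
        · exact ih2 a (Finset.mem_of_mem_erase ha)
      · refine le_trans ?_ ih3
        refine (Finset.card_insert_le _ _).trans ?_
        rw [Finset.card_erase_add_one hg]
    | reduce g₁ g₂ θ h₁ h₂ hθ =>
      have key := fun {w : Term S} (hw : w ∈ F) => Atom.mgu_mem (ih2 _ h₁) (ih2 _ h₂) hθ hw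
      refine ⟨⟨fun i => key (ih1 i), fun a ha => ?_⟩, Finset.card_image_le.trans ih3⟩
      obtain ⟨b, hb, rfl⟩ := Finset.mem_image.1 ha
      have h0 := ih2 b hb
      rcases b with ⟨A, t⟩ | ⟨r, t, t'⟩
      · exact ⟨h0.1, key h0.2⟩
      · exact ⟨h0.1, key h0.2.1, key h0.2.2⟩

/-- The perfect reformulation of a conjunctive query: the union of all queries that can be obtained
from it by steps of the reformulation. -/
noncomputable def CQ.ref {S : Signature.{u}} {n : ℕ} (q : CQ S n) (T : TBox S) : UCQ S n :=
  (finite_reachable T q).toFinset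

open scoped Classical in
/-- The perfect reformulation of a union of conjunctive queries. -/
noncomputable def ref {S : Signature.{u}} {n : ℕ} (Q : UCQ S n) (T : TBox S) : UCQ S n :=
  Q.biUnion fun q => q.ref T

end FuzzyArg

/-!
The equality of the two answer sets reduces to one identity of degrees: for every tuple `t`, the
infimum of the degrees of `Q(t)` over all models of `K` is the degree of the reformulation of `Q`
in the ABox `I_A`. Everything is proved by passing to cuts: for a threshold `β`, the facts of an
interpretation of degree above `β` form a crisp set of facts, and positive inclusions say that
these sets are closed under crisp rules (`FInterp.closed_cut`). Strict thresholds make suprema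
harmless, since a supremum above `β` has a witness above `β`.

*The reformulation is sound.* If a query obtained by a step of the reformulation has a match in a
closed set of facts, so has the query it came from (`Step.matches_of_closed`).

*The reformulation is complete.* For each threshold `α` the assertions of degree at least `α` are
chased: facts are added one at a time, and an inclusion `B ⊑ ∃Q` adds the fact `Q(x, wit x Q)` with
a null `wit x Q`. Given a match of a query in some stage of the chase, the last fact added can
be eliminated: unify the atoms matched to it until only one is left, then rewrite that atom with the
inclusion that produced the fact. When the fact is `Q(x, wit x Q)`, the null occurs in no other
fact, hence the variable matched to it is unbound and the rewriting applies
(`Chase.exists_rewriting`).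

*The canonical model.* Giving each fact the supremum of the thresholds at which it is derived yields
a fuzzy interpretation. It satisfies positive inclusions by construction. For negative ones, the
chase is mapped into a given model of the knowledge base, with degrees above any smaller
threshold; two facts derived at different thresholds can be mapped so that their common terms
have the same image, because a fact about a null is derived at every threshold at which the null
is created (`FAKB.exists_common_hom`). So consistency of `K` makes the canonical interpretation a
model, and the degree of a query in it is at most that of its reformulation in `I_A`.
-/

namespace FuzzyArg

variable {S : Signature.{u}}

/-! ### Facts and matches -/

/-- Facts (ground atoms) over a set `D` of objects. -/
inductive Fact (S : Signature.{u}) (D : Type u) : Type u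
  | concept (A : CName S) (d : D)
  | role (r : RName S) (d e : D)

/-- The object `z` occurs in the fact. -/
def Fact.Mentions {D : Type u} (z : D) : Fact S D → Prop
  | .concept _ d => z = d
  | .role _ d e => z = d ∨ z = e

def Fact.map {D E : Type u} (h : D → E) : Fact S D → Fact S E
  | .concept A d => .concept A (h d)
  | .role r d e => .role r (h d) (h e)

theorem Fact.map_congr {D E : Type u} {h k : D → E} {f : Fact S D}
    (H : ∀ z, f.Mentions z → h z = k z) : f.map h = f.map k := by
  rcases f with ⟨A, d⟩ | ⟨r, d, e⟩
  · simp [Fact.map, H d rfl]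
  · simp [Fact.map, H d (Or.inl rfl), H e (Or.inr rfl)]

theorem Fact.map_map {D E F : Type u} (h : D → E) (k : E → F) (f : Fact S D) :
    (f.map h).map k = f.map (k ∘ h) := by
  cases f <;> rfl

theorem Fact.mentions_map {D E : Type u} {h : D → E} {f : Fact S D} {z : E}
    (H : (f.map h).Mentions z) : ∃ d, z = h d := by
  rcases f with ⟨A, d⟩ | ⟨r, d, e⟩
  · exact ⟨d, H⟩
  · exact H.elim (fun H => ⟨d, H⟩) fun H => ⟨e, H⟩

/-- The fact `Q(d, e)`. -/
def BRole.fact {D : Type u} : BRole S → D → D → Fact S D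
  | .name r, d, e => .role r d e
  | .inv r, d, e => .role r e d

theorem BRole.mentions_fact {D : Type u} (Q : BRole S) (d e z : D) :
    (Q.fact d e).Mentions z ↔ z = d ∨ z = e := by
  cases Q <;> simp [BRole.fact, Fact.Mentions, or_comm]

theorem BRole.map_fact {D E : Type u} (Q : BRole S) (h : D → E) (d e : D) :
    (Q.fact d e).map h = Q.fact (h d) (h e) := by
  cases Q <;> rfl

/-- The facts that witness `B(d)`: the fact `A(d)`, or all the facts `Q(d, e)` if `B = ∃Q`. -/
def BConcept.facts {D : Type u} : BConcept S → D → Set (Fact S D)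
  | .name A, d => {.concept A d}
  | .ex Q, d => Set.range (Q.fact d)

theorem BConcept.mentions_of_mem_facts {D : Type u} {B : BConcept S} {d : D} {f : Fact S D}
    (hf : f ∈ B.facts d) : f.Mentions d := by
  rcases B with A | Q
  · obtain rfl : f = _ := hf
    rfl
  · obtain ⟨e, rfl⟩ := hf
    exact (Q.mentions_fact d e d).2 (Or.inl rfl)

theorem BConcept.map_mem_facts {D E : Type u} {B : BConcept S} {d : D} {f : Fact S D} (h : D → E)
    (hf : f ∈ B.facts d) : f.map h ∈ B.facts (h d) := by
  rcases B with A | Q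
  · obtain rfl : f = _ := hf
    rfl
  · obtain ⟨e, rfl⟩ := hf
    exact ⟨h e, (Q.map_fact h d e).symm⟩

/-- `B(d)` holds in the set `X` of facts. -/
def BConcept.HoldsIn {D : Type u} (B : BConcept S) (X : Set (Fact S D)) (d : D) : Prop :=
  ∃ f ∈ X, f ∈ B.facts d

/-- The set `X` of facts satisfies the positive inclusions of `T`. -/
structure Closed {D : Type u} (T : TBox S) (X : Set (Fact S D)) : Prop where
  concept : ∀ {B B' d}, Inclusion.concept B B' ∈ T → B.HoldsIn X d → B'.HoldsIn X d
  role : ∀ {Q Q' d e}, Inclusion.role Q Q' ∈ T → Q.fact d e ∈ X → Q'.fact d e ∈ X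

/-- The value of a term, given the objects `j a` denoted by the individuals. -/
def Term.value {D : Type u} (j : Ind S → D) (σ : ℕ → D) : Term S → D
  | .var x => σ x
  | .const a => j a

/-- The instance of an atom under an assignment. -/
def Atom.fact {D : Type u} (j : Ind S → D) (σ : ℕ → D) : Atom S → Fact S D
  | .concept A t => .concept A (t.value j σ)
  | .role r t t' => .role r (t.value j σ) (t'.value j σ)

theorem BRole.fact_atom {D : Type u} (Q : BRole S) (j : Ind S → D) (σ : ℕ → D) (s s' : Term S) :
    (Q.atom s s').fact j σ = Q.fact (s.value j σ) (s'.value j σ) := by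
  cases Q <;> rfl

theorem BRole.count_vars_atom (Q : BRole S) (s : Term S) (y : ℕ) :
    (Q.atom s (.var y)).vars.count y = s.vars.count y + 1 := by
  cases Q <;> simp [BRole.atom, Atom.vars, Term.vars, add_comm]

theorem BRole.exists_atom_eq {D : Type u} {Q : BRole S} {j : Ind S → D} {σ : ℕ → D} {g : Atom S}
    {d e : D} (h : g.fact j σ = Q.fact d e) :
    ∃ s s', g = Q.atom s s' ∧ s.value j σ = d ∧ s'.value j σ = e := by
  rcases Q with r | r <;> rcases g with ⟨A, s⟩ | ⟨r', s, s'⟩ <;>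
    simp only [Atom.fact, BRole.fact, Fact.role.injEq, reduceCtorEq] at h
  · obtain ⟨rfl, h1, h2⟩ := h
    exact ⟨s, s', rfl, h1, h2⟩
  · obtain ⟨rfl, h1, h2⟩ := h
    exact ⟨s', s, rfl, h2, h1⟩

theorem Term.value_congr {D : Type u} {j : Ind S → D} {σ τ : ℕ → D} {t : Term S}
    (h : ∀ x ∈ t.vars, σ x = τ x) : t.value j σ = t.value j τ := by
  rcases t with x | a
  · exact h x (by simp [Term.vars])
  · rfl

theorem Atom.fact_congr {D : Type u} {j : Ind S → D} {σ τ : ℕ → D} {g : Atom S}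
    (h : ∀ x ∈ g.vars, σ x = τ x) : g.fact j σ = g.fact j τ := by
  rcases g with ⟨A, t⟩ | ⟨r, t, t'⟩
  · exact congrArg _ (Term.value_congr h)
  · have h1 : t.value j σ = t.value j τ :=
      Term.value_congr fun x hx => h x (Multiset.mem_add.2 (Or.inl hx))
    have h2 : t'.value j σ = t'.value j τ :=
      Term.value_congr fun x hx => h x (Multiset.mem_add.2 (Or.inr hx))
    simp only [Atom.fact, h1, h2]

theorem update_eq_of_notMem {D : Type u} {σ : ℕ → D} {y : ℕ} {e : D} {M : Multiset ℕ} (hy : y ∉ M) :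
    ∀ x ∈ M, Function.update σ y e x = σ x := by
  intro x hx
  refine Function.update_of_ne ?_ _ _
  rintro rfl
  exact hy hx

theorem Term.value_subst {D : Type u} (j : Ind S → D) (σ : ℕ → D) (θ : ℕ → Term S) (t : Term S) :
    (t.subst θ).value j σ = t.value j fun x => (θ x).value j σ := by
  cases t <;> rfl

theorem Atom.fact_subst {D : Type u} (j : Ind S → D) (σ : ℕ → D) (θ : ℕ → Term S) (g : Atom S) :
    (g.subst θ).fact j σ = g.fact j fun x => (θ x).value j σ := by
  cases g <;> simp [Atom.subst, Atom.fact, Term.value_subst]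

theorem Atom.mentions_of_mem_vars {D : Type u} {j : Ind S → D} {σ : ℕ → D} {g : Atom S} {x : ℕ}
    (hx : x ∈ g.vars) : (g.fact j σ).Mentions (σ x) := by
  have key : ∀ t : Term S, x ∈ t.vars → σ x = t.value j σ := by
    rintro (y | a) h
    · rw [Multiset.mem_singleton.1 h]; rfl
    · simp [Term.vars] at h
  rcases g with ⟨A, t⟩ | ⟨r, t, t'⟩
  · exact key t hx
  · exact (Multiset.mem_add.1 hx).imp (key t) (key t')

/-- `σ` maps the body of `q` into `X` and the head of `q` to the tuple of individuals `t`. -/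
structure CQ.Matches {n : ℕ} {D : Type u} (q : CQ S n) (j : Ind S → D) (X : Set (Fact S D))
    (t : Fin n → Ind S) (σ : ℕ → D) : Prop where
  head : ∀ i, (q.head i).value j σ = j (t i)
  body : ∀ g ∈ q.body, g.fact j σ ∈ X

theorem CQ.mem_headVars {n : ℕ} {q : CQ S n} {i : Fin n} {x : ℕ} (h : x ∈ (q.head i).vars) :
    x ∈ q.headVars :=
  Multiset.mem_sum.2 ⟨i, Finset.mem_univ i, h⟩

theorem CQ.mem_bodyVars {n : ℕ} {q : CQ S n} {g : Atom S} {x : ℕ} (hg : g ∈ q.body)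
    (h : x ∈ g.vars) : x ∈ q.bodyVars :=
  Multiset.mem_sum.2 ⟨g, hg, h⟩

theorem CQ.fresh_notMem {n : ℕ} (q : CQ S n) : q.fresh ∉ q.headVars + q.bodyVars := by
  have hne : {x | x ∉ q.headVars + q.bodyVars}.Nonempty := by
    obtain ⟨x, hx⟩ := Infinite.exists_notMem_finset (q.headVars + q.bodyVars).toFinset
    exact ⟨x, fun h => hx (Multiset.mem_toFinset.2 h)⟩
  exact Nat.sInf_mem hne

theorem CQ.fresh_notMem_headVars {n : ℕ} (q : CQ S n) : q.fresh ∉ q.headVars := fun h =>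
  q.fresh_notMem (Multiset.mem_add.2 (Or.inl h))

theorem CQ.fresh_notMem_bodyVars {n : ℕ} (q : CQ S n) : q.fresh ∉ q.bodyVars := fun h =>
  q.fresh_notMem (Multiset.mem_add.2 (Or.inr h))

theorem BConcept.fact_atom_mem {D : Type u} (B : BConcept S) (j : Ind S → D) (σ : ℕ → D)
    (s : Term S) (y : ℕ) : (B.atom s y).fact j σ ∈ B.facts (s.value j σ) := by
  rcases B with A | Q
  · rfl
  · exact ⟨σ y, (Q.fact_atom j σ s (.var y)).symm⟩

/-! ### Soundness of the reformulation -/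

theorem CQ.Matches.of_subst {n : ℕ} {D : Type u} {q : CQ S n} {j : Ind S → D}
    {X : Set (Fact S D)} {t : Fin n → Ind S} {σ : ℕ → D} {θ : ℕ → Term S}
    (h : (q.subst θ).Matches j X t σ) : q.Matches j X t fun x => (θ x).value j σ := by
  classical
  refine ⟨fun i => ?_, fun g hg => ?_⟩
  · rw [← Term.value_subst]
    exact h.head i
  · rw [← Atom.fact_subst]
    exact h.body _ (Finset.mem_image_of_mem _ hg)

theorem Step.matches_of_closed {n : ℕ} {D : Type u} {T : TBox S} {q q' : CQ S n} {j : Ind S → D}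
    {X : Set (Fact S D)} {t : Fin n → Ind S} {σ : ℕ → D} (hX : Closed T X) (hs : Step T q q')
    (h : q'.Matches j X t σ) : ∃ τ, q.Matches j X t τ := by
  classical
  cases hs with
  | reduce g₁ g₂ θ _ _ _ => exact ⟨_, h.of_subst⟩
  | rewrite g g' hg hr =>
    have hg' : g'.fact j σ ∈ X := h.body g' (Finset.mem_insert_self _ _)
    have hrest : ∀ a ∈ q.body, a ≠ g → a.fact j σ ∈ X := fun a ha hne =>
      h.body a (Finset.mem_insert_of_mem (Finset.mem_erase.2 ⟨hne, ha⟩))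
    have same : g.fact j σ ∈ X → ∃ τ, q.Matches j X t τ := fun hgX =>
      ⟨σ, h.head, fun a ha => if hag : a = g then hag ▸ hgX else hrest a ha hag⟩
    cases hr with
    | name B A s hT =>
      obtain ⟨f, hf, hfB⟩ := hX.concept hT ⟨_, hg', B.fact_atom_mem j σ s _⟩
      obtain rfl : f = _ := hfB
      exact same hf
    | role Q Q' s s' hT =>
      refine same ?_
      rw [BRole.fact_atom] at hg' ⊢
      exact hX.role hT hg'
    | ex B Q s s' hT hu =>
      obtain ⟨f, hf, e, rfl⟩ := hX.concept hT ⟨_, hg', B.fact_atom_mem j σ s _⟩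
      obtain ⟨y, rfl, hyh, hyc⟩ := hu
      -- `y` occurs once in the body, namely as the second term of the rewritten atom
      have hsum : (Q.atom s (.var y)).vars.count y +
          ∑ a ∈ q.body.erase (Q.atom s (.var y)), a.vars.count y = 1 := by
        rw [Finset.add_sum_erase _ (fun a : Atom S => a.vars.count y) hg, ← hyc, CQ.bodyVars,
          Multiset.count_sum']
      have hcount := Q.count_vars_atom s y
      have hys : y ∉ s.vars := by
        rw [← Multiset.count_eq_zero]; omega
      have hyrest : ∀ a ∈ q.body, a ≠ Q.atom s (.var y) → y ∉ a.vars := by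
        intro a ha hne
        rw [← Multiset.count_eq_zero]
        have h0 : ∑ a ∈ q.body.erase (Q.atom s (.var y)), a.vars.count y = 0 := by omega
        exact Finset.sum_eq_zero_iff.1 h0 a (Finset.mem_erase.2 ⟨hne, ha⟩)
      refine ⟨Function.update σ y e, fun i => ?_, fun a ha => ?_⟩
      · rw [Term.value_congr (update_eq_of_notMem fun hy => hyh (CQ.mem_headVars hy))]
        exact h.head i
      · by_cases hag : a = Q.atom s (.var y)
        · subst hag
          rw [BRole.fact_atom, Term.value_congr (update_eq_of_notMem hys)]
          simpa [Term.value] using hf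
        · rw [Atom.fact_congr (update_eq_of_notMem (hyrest a ha hag))]
          exact hrest a ha hag

theorem CQ.matches_of_reachable {n : ℕ} {D : Type u} {T : TBox S} {q q' : CQ S n}
    {j : Ind S → D} {X : Set (Fact S D)} {t : Fin n → Ind S} (hX : Closed T X)
    (hs : Relation.ReflTransGen (Step T) q q') (h : ∃ σ, q'.Matches j X t σ) :
    ∃ σ, q.Matches j X t σ := by
  induction hs with
  | refl => exact h
  | tail _ hstep ih =>
    obtain ⟨σ, h⟩ := h
    exact ih (hstep.matches_of_closed hX h)

/-! ### The chase -/

/-- The objects of the canonical model: individuals, and for each object `x` and basic role `Q` a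
null `wit x Q` that serves as the `Q`-successor of `x` whenever `∃Q(x)` is derived. -/
inductive Elt (S : Signature.{u}) : Type u
  | ind (a : Ind S)
  | wit (x : Elt S) (Q : BRole S)

theorem Elt.ne_wit (x : Elt S) (Q : BRole S) : x ≠ .wit x Q := by
  intro h
  have := congrArg sizeOf h
  rw [Elt.wit.sizeOf_spec] at this
  omega

/-- The fact follows from `X` by one application of a positive inclusion of `T`. -/
inductive Derive (T : TBox S) (X : Set (Fact S (Elt S))) : Fact S (Elt S) → Prop
  | name {B A x} : Inclusion.concept B (.name A) ∈ T → B.HoldsIn X x → Derive T X (.concept A x)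
  | ex {B Q x} : Inclusion.concept B (.ex Q) ∈ T → B.HoldsIn X x →
      Derive T X (Q.fact x (.wit x Q))
  | role {Q Q' x y} : Inclusion.role Q Q' ∈ T → Q.fact x y ∈ X → Derive T X (Q'.fact x y)

/-- The stages of the chase of `X₀`: finitely many derived facts are added, one after the other. -/
inductive Chase (T : TBox S) (X₀ : Set (Fact S (Elt S))) : Set (Fact S (Elt S)) → Prop
  | base : Chase T X₀ X₀
  | step {X f} : Chase T X₀ X → Derive T X f → Chase T X₀ (insert f X)

/-- The facts that occur at some stage of the chase of `X₀`. -/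
def chase (T : TBox S) (X₀ : Set (Fact S (Elt S))) : Set (Fact S (Elt S)) :=
  {f | ∃ X, Chase T X₀ X ∧ f ∈ X}

/-- No fact of `X` mentions a null. -/
def NullFree (X : Set (Fact S (Elt S))) : Prop :=
  ∀ f ∈ X, ∀ z, f.Mentions z → ∃ a, z = .ind a

theorem Derive.mono {T : TBox S} {X Y : Set (Fact S (Elt S))} {f : Fact S (Elt S)} (hXY : X ⊆ Y)
    (h : Derive T X f) : Derive T Y f := by
  cases h with
  | name hT h => exact .name hT (h.imp fun _ h => ⟨hXY h.1, h.2⟩)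
  | ex hT h => exact .ex hT (h.imp fun _ h => ⟨hXY h.1, h.2⟩)
  | role hT h => exact .role hT (hXY h)

theorem Chase.subset {T : TBox S} {X₀ X : Set (Fact S (Elt S))} (h : Chase T X₀ X) : X₀ ⊆ X := by
  induction h with
  | base => exact subset_rfl
  | step _ _ ih => exact ih.trans (Set.subset_insert _ _)

theorem Chase.union {T : TBox S} {X₀ Y₀ X Y : Set (Fact S (Elt S))} (h₀ : X₀ ⊆ Y₀)
    (hX : Chase T X₀ X) (hY : Chase T Y₀ Y) : Chase T Y₀ (X ∪ Y) := by
  induction hX with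
  | base => rwa [Set.union_eq_self_of_subset_left (h₀.trans hY.subset)]
  | step _ hd ih =>
    rw [Set.insert_union]
    exact .step ih (hd.mono Set.subset_union_left)

theorem chase_mono {T : TBox S} {X₀ Y₀ : Set (Fact S (Elt S))} (h₀ : X₀ ⊆ Y₀) :
    chase T X₀ ⊆ chase T Y₀ := fun _ ⟨_, hX, hf⟩ => ⟨_, hX.union h₀ .base, Or.inl hf⟩

theorem exists_chase_of_finset {T : TBox S} {X₀ : Set (Fact S (Elt S))}
    {F : Finset (Fact S (Elt S))} (hF : ∀ f ∈ F, f ∈ chase T X₀) :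
    ∃ X, Chase T X₀ X ∧ ∀ f ∈ F, f ∈ X := by
  classical
  induction F using Finset.induction_on with
  | empty => exact ⟨X₀, .base, by simp⟩
  | insert a F _ ih =>
    obtain ⟨X, hX, hXF⟩ := ih fun f hf => hF f (Finset.mem_insert_of_mem hf)
    obtain ⟨Y, hY, haY⟩ := hF a (Finset.mem_insert_self _ _)
    refine ⟨Y ∪ X, hY.union subset_rfl hX, fun f hf => ?_⟩
    rcases Finset.mem_insert.1 hf with rfl | hf
    · exact Or.inl haY
    · exact Or.inr (hXF f hf)

theorem Derive.mem_chase {T : TBox S} {X₀ : Set (Fact S (Elt S))} {f : Fact S (Elt S)}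
    (h : Derive T (chase T X₀) f) : f ∈ chase T X₀ := by
  cases h with
  | name hT h =>
    obtain ⟨g, ⟨X, hX, hg⟩, hgB⟩ := h
    exact ⟨_, .step hX (.name hT ⟨g, hg, hgB⟩), Set.mem_insert _ _⟩
  | ex hT h =>
    obtain ⟨g, ⟨X, hX, hg⟩, hgB⟩ := h
    exact ⟨_, .step hX (.ex hT ⟨g, hg, hgB⟩), Set.mem_insert _ _⟩
  | role hT h =>
    obtain ⟨X, hX, hg⟩ := h
    exact ⟨_, .step hX (.role hT hg), Set.mem_insert _ _⟩

theorem closed_chase (T : TBox S) (X₀ : Set (Fact S (Elt S))) : Closed T (chase T X₀) where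
  concept {B B' d} hT h := by
    rcases B' with A | Q
    · exact ⟨_, (Derive.name hT h).mem_chase, rfl⟩
    · exact ⟨_, (Derive.ex hT h).mem_chase, _, rfl⟩
  role hT h := (Derive.role hT h).mem_chase

/-- The first fact that mentions a null is the one that creates it. -/
theorem Chase.creation_mem {T : TBox S} {X₀ X : Set (Fact S (Elt S))} (h₀ : NullFree X₀)
    (h : Chase T X₀ X) {f : Fact S (Elt S)} (hf : f ∈ X) {x : Elt S} {Q : BRole S}
    (hm : f.Mentions (.wit x Q)) : Q.fact x (.wit x Q) ∈ X := by
  induction h generalizing f with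
  | base =>
    obtain ⟨a, ha⟩ := h₀ f hf _ hm
    cases ha
  | step _ hd ih =>
    rcases hf with rfl | hf
    swap
    · exact Or.inr (ih hf hm)
    cases hd with
    | name hT hB =>
      obtain ⟨g, hg, hgB⟩ := hB
      have hz := BConcept.mentions_of_mem_facts hgB
      rw [← show _ = _ from hm] at hz
      exact Or.inr (ih hg hz)
    | @ex B Q' z hT hB =>
      rcases (BRole.mentions_fact _ _ _ _).1 hm with hz | hz
      · obtain ⟨g, hg, hgB⟩ := hB
        exact Or.inr (ih hg (hz ▸ BConcept.mentions_of_mem_facts hgB))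
      · cases hz
        exact Or.inl rfl
    | role hT hQ =>
      exact Or.inr (ih hQ ((BRole.mentions_fact _ _ _ _).2 ((BRole.mentions_fact _ _ _ _).1 hm)))

/-- What is derived about a null follows from the fact that creates it, whatever the chase was
started from. -/
theorem mem_chase_of_creation_mem {T : TBox S} {X₀ Y₀ : Set (Fact S (Elt S))} (h₀ : NullFree Y₀)
    {x : Elt S} {Q : BRole S} (hc : Q.fact x (.wit x Q) ∈ chase T X₀) {f : Fact S (Elt S)}
    (hf : f ∈ chase T Y₀) (hm : f.Mentions (.wit x Q)) : f ∈ chase T X₀ := by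
  obtain ⟨Y, hY, hf⟩ := hf
  induction hY generalizing f with
  | base =>
    obtain ⟨a, ha⟩ := h₀ f hf _ hm
    cases ha
  | step _ hd ih =>
    rcases hf with rfl | hf
    swap
    · exact ih hm hf
    cases hd with
    | name hT hB =>
      obtain ⟨g, hg, hgB⟩ := hB
      have hz := BConcept.mentions_of_mem_facts hgB
      rw [← show _ = _ from hm] at hz
      exact (Derive.name hT ⟨g, ih hz hg, hgB⟩).mem_chase
    | @ex B Q' z hT hB =>
      rcases (BRole.mentions_fact _ _ _ _).1 hm with hz | hz
      · obtain ⟨g, hg, hgB⟩ := hB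
        have hz' := BConcept.mentions_of_mem_facts hgB
        rw [← hz] at hz'
        exact (Derive.ex hT ⟨g, ih hz' hg, hgB⟩).mem_chase
      · cases hz
        exact hc
    | role hT hQ =>
      rw [BRole.mentions_fact] at hm
      exact (Derive.role hT (ih ((BRole.mentions_fact _ _ _ _).2 hm) hQ)).mem_chase

/-- The chase maps homomorphically into every closed set of facts that contains the image of the
facts it starts from. -/
theorem Chase.exists_hom {D : Type u} {T : TBox S} {X₀ X : Set (Fact S (Elt S))}
    (h₀ : NullFree X₀) (hX : Chase T X₀ X) {Y : Set (Fact S D)} (hY : Closed T Y)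
    (k : Elt S → D) (hk : ∀ f ∈ X₀, f.map k ∈ Y) :
    ∃ h : Elt S → D, (∀ a, h (.ind a) = k (.ind a)) ∧ ∀ f ∈ X, f.map h ∈ Y := by
  classical
  induction hX with
  | base => exact ⟨k, fun _ => rfl, hk⟩
  | @step X f hX hd ih =>
    obtain ⟨h, hind, hXY⟩ := ih
    by_cases hfX : f ∈ X
    · exact ⟨h, hind, by rwa [Set.insert_eq_of_mem hfX]⟩
    cases hd with
    | @name B A x hT hB =>
      refine ⟨h, hind, ?_⟩
      rintro _ (rfl | hf)
      swap
      · exact hXY _ hf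
      obtain ⟨g, hg, hgB⟩ := hB
      obtain ⟨f, hf, hfA⟩ := hY.concept hT ⟨_, hXY g hg, BConcept.map_mem_facts h hgB⟩
      obtain rfl : f = _ := hfA
      exact hf
    | @role Q Q' x y hT hQ =>
      refine ⟨h, hind, ?_⟩
      rintro _ (rfl | hf)
      swap
      · exact hXY _ hf
      have := hXY _ hQ
      rw [BRole.map_fact] at this ⊢
      exact hY.role hT this
    | @ex B Q x hT hB =>
      obtain ⟨g, hg, hgB⟩ := hB
      obtain ⟨_, hf, e, rfl⟩ := hY.concept hT ⟨_, hXY g hg, BConcept.map_mem_facts h hgB⟩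
      refine ⟨Function.update h (.wit x Q) e, fun a => ?_, ?_⟩
      · rw [Function.update_of_ne (by simp), hind]
      rintro f' (rfl | hf')
      · rw [BRole.map_fact, Function.update_self, Function.update_of_ne (Elt.ne_wit x Q)]
        exact hf
      · rw [Fact.map_congr (k := h)]
        · exact hXY f' hf'
        · intro z hz
          refine Function.update_of_ne ?_ _ _
          rintro rfl
          exact hfX (hX.creation_mem h₀ hf' hz)

/-! ### Completeness of the reformulation -/

theorem Term.mgu_unifies {s t : Term S} {θ : ℕ → Term S} (h : s.mgu t = some θ) :
    s.subst θ = t.subst θ := by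
  rcases s with x | a <;> rcases t with y | b
  · simp only [Term.mgu, Option.some.injEq] at h
    subst h
    by_cases hxy : y = x
    · rw [hxy]
    · simp [Term.subst, Function.update_of_ne hxy]
  · simp only [Term.mgu, Option.some.injEq] at h
    subst h
    simp [Term.subst]
  · simp only [Term.mgu, Option.some.injEq] at h
    subst h
    simp [Term.subst]
  · simp only [Term.mgu, Option.ite_none_right_eq_some] at h
    rw [h.1]

theorem Atom.mgu_unifies {g g' : Atom S} {θ : ℕ → Term S} (h : g.mgu g' = some θ) :
    g.subst θ = g'.subst θ := by
  rcases g with ⟨A, t⟩ | ⟨r, t, t'⟩ <;> rcases g' with ⟨A', v⟩ | ⟨r', v, v'⟩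
  · simp only [Atom.mgu, Option.ite_none_right_eq_some] at h
    simp only [Atom.subst, h.1, Term.mgu_unifies h.2]
  · simp [Atom.mgu] at h
  · simp [Atom.mgu] at h
  · simp only [Atom.mgu, Option.ite_none_right_eq_some, Option.bind_eq_some_iff,
      Option.map_eq_some_iff] at h
    obtain ⟨rfl, θ₁, h₁, η, h₂, rfl⟩ := h
    simp only [Atom.subst, Term.subst_subst, Term.mgu_unifies h₁, Term.mgu_unifies h₂]

/-- Terms with equal value under `σ` have a most general unifier, and `σ` factors through it. -/
theorem Term.exists_mgu {D : Type u} {j : Ind S → D} (hj : Function.Injective j) {σ : ℕ → D}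
    {s t : Term S} (h : s.value j σ = t.value j σ) :
    ∃ θ, s.mgu t = some θ ∧ ∀ x, (θ x).value j σ = σ x := by
  have upd : ∀ (x : ℕ) (u : Term S), u.value j σ = σ x →
      ∀ y, (Function.update Term.var x u y).value j σ = σ y := by
    intro x u hu y
    by_cases hy : y = x
    · rw [hy, Function.update_self, hu]
    · rw [Function.update_of_ne hy]; rfl
  rcases s with x | a
  · exact ⟨_, rfl, upd x t h.symm⟩
  · rcases t with y | b
    · exact ⟨_, rfl, upd y _ h⟩
    · exact ⟨_, if_pos (hj h), fun _ => rfl⟩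

theorem Atom.exists_mgu {D : Type u} {j : Ind S → D} (hj : Function.Injective j) {σ : ℕ → D}
    {g g' : Atom S} (h : g.fact j σ = g'.fact j σ) :
    ∃ θ, g.mgu g' = some θ ∧ ∀ x, (θ x).value j σ = σ x := by
  rcases g with ⟨A, t⟩ | ⟨r, t, t'⟩ <;> rcases g' with ⟨A', v⟩ | ⟨r', v, v'⟩ <;>
    simp only [Atom.fact, Fact.concept.injEq, Fact.role.injEq, reduceCtorEq] at h
  · obtain ⟨rfl, h⟩ := h
    obtain ⟨θ, h1, h2⟩ := Term.exists_mgu hj h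
    exact ⟨θ, by simpa [Atom.mgu] using h1, h2⟩
  · obtain ⟨rfl, h, h'⟩ := h
    obtain ⟨θ, h1, h2⟩ := Term.exists_mgu hj h
    obtain ⟨η, h3, h4⟩ := Term.exists_mgu (s := t'.subst θ) (t := v'.subst θ) (σ := σ) hj
      (by simpa only [Term.value_subst, h2] using h')
    refine ⟨fun x => (θ x).subst η, by simp [Atom.mgu, h1, h3], fun x => ?_⟩
    simp only [Term.value_subst, h4, h2]

/-- Two atoms matched to the same fact can be unified, keeping the match. -/
theorem CQ.Matches.exists_reduce {n : ℕ} {D : Type u} {T : TBox S} {q : CQ S n} {j : Ind S → D}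
    (hj : Function.Injective j) {X : Set (Fact S D)} {t : Fin n → Ind S} {σ : ℕ → D}
    (h : q.Matches j X t σ) {g g' : Atom S} (hg : g ∈ q.body) (hg' : g' ∈ q.body) (hne : g ≠ g')
    (heq : g.fact j σ = g'.fact j σ) :
    ∃ q', Step T q q' ∧ q'.Matches j X t σ ∧ q'.body.card < q.body.card := by
  classical
  obtain ⟨θ, hθ, hσ⟩ := Atom.exists_mgu hj heq
  refine ⟨q.subst θ, .reduce q g g' θ hg hg' hθ, ⟨fun i => ?_, fun a ha => ?_⟩, ?_⟩
  · rw [← h.head i]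
    simp only [CQ.subst, Term.value_subst, hσ]
  · obtain ⟨b, hb, rfl⟩ := Finset.mem_image.1 ha
    simp only [Atom.fact_subst, hσ]
    exact h.body b hb
  · refine lt_of_le_of_ne Finset.card_image_le fun hc => hne ?_
    exact Finset.card_image_iff.1 hc hg hg' (Atom.mgu_unifies hθ)

/-- The atom for `B(s)` replaces an atom `g` of `q` in a match, provided that all other atoms are
matched into `X` and `B` holds in `X` at the value of `s`: the fresh variable is sent to a witness
of `B`. -/
theorem CQ.Matches.replace_concept {n : ℕ} {D : Type u} {q : CQ S n} {j : Ind S → D}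
    {X : Set (Fact S D)} {t : Fin n → Ind S} {σ : ℕ → D} {g : Atom S} {B : BConcept S}
    {s : Term S} (hh : ∀ i, (q.head i).value j σ = j (t i))
    (hb : ∀ a ∈ q.body, a ≠ g → a.fact j σ ∈ X) (hg : g ∈ q.body)
    (hs : ∀ x ∈ s.vars, x ∈ g.vars) (hB : B.HoldsIn X (s.value j σ)) :
    ∃ τ, (q.replace g (B.atom s q.fresh)).Matches j X t τ := by
  classical
  obtain ⟨e, he⟩ : ∃ e, (B.atom s q.fresh).fact j (Function.update σ q.fresh e) ∈ X := by
    obtain ⟨f, hf, hfB⟩ := hB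
    have hval : ∀ e, s.value j (Function.update σ q.fresh e) = s.value j σ := fun e =>
      Term.value_congr (update_eq_of_notMem fun h =>
        q.fresh_notMem_bodyVars (CQ.mem_bodyVars hg (hs _ h)))
    rcases B with A | Q
    · obtain rfl : f = _ := hfB
      exact ⟨σ 0, by simpa only [BConcept.atom, Atom.fact, hval] using hf⟩
    · obtain ⟨e, rfl⟩ := hfB
      refine ⟨e, ?_⟩
      rw [BConcept.atom, BRole.fact_atom, hval]
      simpa [Term.value] using hf
  refine ⟨Function.update σ q.fresh e, fun i => ?_, fun a ha => ?_⟩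
  · rw [← hh i]
    exact Term.value_congr (update_eq_of_notMem fun h =>
      q.fresh_notMem_headVars (CQ.mem_headVars h))
  · rcases Finset.mem_insert.1 ha with rfl | ha
    · exact he
    · obtain ⟨hne, ha⟩ := Finset.mem_erase.1 ha
      rw [Atom.fact_congr (update_eq_of_notMem fun h =>
        q.fresh_notMem_bodyVars (CQ.mem_bodyVars ha h))]
      exact hb a ha hne

/-- If a single atom is matched to the fact added last, rewriting it with the inclusion that
produced this fact gives a query matched in the previous stage. -/
theorem Chase.exists_rewrite {n : ℕ} {T : TBox S} {X₀ X : Set (Fact S (Elt S))}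
    (h₀ : NullFree X₀) (hX : Chase T X₀ X) {f : Fact S (Elt S)} (hfX : f ∉ X)
    (hd : Derive T X f) {q : CQ S n} {t : Fin n → Ind S} {σ : ℕ → Elt S}
    (hh : ∀ i, (q.head i).value Elt.ind σ = .ind (t i)) {g : Atom S} (hg : g ∈ q.body)
    (hgf : g.fact Elt.ind σ = f) (hb : ∀ a ∈ q.body, a ≠ g → a.fact Elt.ind σ ∈ X) :
    ∃ q' τ, Step T q q' ∧ q'.Matches Elt.ind X t τ := by
  classical
  cases hd with
  | @name B A x hT hB =>
    rcases g with ⟨A', s⟩ | ⟨r, s, s'⟩ <;>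
      simp only [Atom.fact, Fact.concept.injEq, reduceCtorEq] at hgf
    obtain ⟨rfl, rfl⟩ := hgf
    obtain ⟨τ, hτ⟩ := CQ.Matches.replace_concept hh hb hg (fun _ h => h) hB
    exact ⟨_, τ, .rewrite q _ _ hg (.name B A' s hT), hτ⟩
  | @role Q Q' x y hT hQ =>
    obtain ⟨s, s', rfl, rfl, rfl⟩ := BRole.exists_atom_eq hgf
    refine ⟨_, σ, .rewrite q _ _ hg (.role Q Q' s s' hT), hh, fun a ha => ?_⟩
    rcases Finset.mem_insert.1 ha with rfl | ha
    · rwa [BRole.fact_atom]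
    · exact hb a (Finset.mem_of_mem_erase ha) (Finset.ne_of_mem_erase ha)
  | @ex B Q x hT hB =>
    obtain ⟨s, s', rfl, rfl, hs'⟩ := BRole.exists_atom_eq hgf
    rcases s' with y | a
    swap
    · cases hs'
    have hs' : σ y = .wit (s.value Elt.ind σ) Q := hs'
    -- the null is new, so no other atom and no answer term can be matched to it
    have hyrest : ∀ a ∈ q.body, a ≠ Q.atom s (.var y) → y ∉ a.vars := fun a ha hne hy =>
      hfX (hX.creation_mem h₀ (hb a ha hne) (hs' ▸ Atom.mentions_of_mem_vars hy))
    have hys : y ∉ s.vars := by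
      intro hy
      rcases s with z | a
      · rw [Term.vars, Multiset.mem_singleton] at hy
        subst hy
        exact Elt.ne_wit _ _ hs'
      · simp [Term.vars] at hy
    have hyh : y ∉ q.headVars := by
      intro hy
      obtain ⟨i, -, hi⟩ := Multiset.mem_sum.1 hy
      have hhi := hh i
      rcases hqi : q.head i with z | a
      · rw [hqi, Term.vars, Multiset.mem_singleton] at hi
        subst hi
        rw [hqi, Term.value, hs'] at hhi
        cases hhi
      · rw [hqi] at hi
        simp [Term.vars] at hi
    have hcount : q.bodyVars.count y = 1 := by
      rw [CQ.bodyVars, Multiset.count_sum', Finset.sum_eq_single_of_mem _ hg]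
      · rw [Q.count_vars_atom, Multiset.count_eq_zero.2 hys]
      · exact fun a ha hne => Multiset.count_eq_zero.2 (hyrest a ha hne)
    obtain ⟨τ, hτ⟩ := CQ.Matches.replace_concept hh hb hg (s := s) (fun z hz => by
      cases Q <;> simp [BRole.atom, Atom.vars, hz]) hB
    exact ⟨_, τ, .rewrite q _ _ hg (.ex B Q s _ hT ⟨y, rfl, hyh, hcount⟩), hτ⟩

theorem Chase.exists_reachable_of_insert {n : ℕ} {T : TBox S} {X₀ X : Set (Fact S (Elt S))}
    (h₀ : NullFree X₀) (hX : Chase T X₀ X) {f : Fact S (Elt S)} (hfX : f ∉ X)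
    (hd : Derive T X f) {q : CQ S n} {t : Fin n → Ind S} {σ : ℕ → Elt S}
    (h : q.Matches Elt.ind (insert f X) t σ) :
    ∃ q' τ, Relation.ReflTransGen (Step T) q q' ∧ q'.Matches Elt.ind X t τ := by
  induction hc : q.body.card using Nat.strong_induction_on generalizing q with
  | _ c ih =>
    by_cases hg : ∃ g ∈ q.body, g.fact Elt.ind σ = f
    swap
    · push Not at hg
      exact ⟨q, σ, .refl, h.head, fun a ha => (h.body a ha).resolve_left (hg a ha)⟩
    obtain ⟨g, hg, hgf⟩ := hg
    by_cases hu : ∃ g' ∈ q.body, g' ≠ g ∧ g'.fact Elt.ind σ = f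
    · obtain ⟨g', hg', hne, hgf'⟩ := hu
      obtain ⟨q₁, hs, hm, hlt⟩ := h.exists_reduce (T := T) (fun _ _ h => Elt.ind.inj h) hg' hg hne
        (hgf'.trans hgf.symm)
      obtain ⟨q', τ, hr, hτ⟩ := ih _ (hc ▸ hlt) hm rfl
      exact ⟨q', τ, .head hs hr, hτ⟩
    · push Not at hu
      obtain ⟨q', τ, hs, hτ⟩ := hX.exists_rewrite h₀ hfX hd h.head hg hgf fun a ha hne =>
        (h.body a ha).resolve_left (hu a ha hne)
      exact ⟨q', τ, .single hs, hτ⟩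

theorem Chase.exists_rewriting {n : ℕ} {T : TBox S} {X₀ X : Set (Fact S (Elt S))}
    (h₀ : NullFree X₀) (hX : Chase T X₀ X) {q : CQ S n} {t : Fin n → Ind S} {σ : ℕ → Elt S}
    (h : q.Matches Elt.ind X t σ) :
    ∃ q' τ, Relation.ReflTransGen (Step T) q q' ∧ q'.Matches Elt.ind X₀ t τ := by
  induction hX generalizing q σ with
  | base => exact ⟨q, σ, .refl, h⟩
  | @step X f hX hd ih =>
    by_cases hfX : f ∈ X
    · rw [Set.insert_eq_of_mem hfX] at h
      exact ih h
    · obtain ⟨q₁, σ₁, hr₁, h₁⟩ := hX.exists_reachable_of_insert h₀ hfX hd h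
      obtain ⟨q₂, σ₂, hr₂, h₂⟩ := ih h₁
      exact ⟨q₂, σ₂, hr₁.trans hr₂, h₂⟩

/-! ### Degrees and cuts -/

def FInterp.factDegree (I : FInterp S) : Fact S I.Dom → unitInterval
  | .concept A d => I.concept A d
  | .role r d e => I.role r d e

theorem FInterp.factDegree_fact (I : FInterp S) (Q : BRole S) (d e : I.Dom) :
    I.factDegree (Q.fact d e) = I.brole Q d e := by
  cases Q <;> rfl

theorem Term.value_eq_eval (I : FInterp S) (σ : ℕ → I.Dom) (s : Term S) :
    s.value I.ind σ = s.eval I σ := by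
  cases s <;> rfl

theorem FInterp.factDegree_atom (I : FInterp S) (σ : ℕ → I.Dom) (g : Atom S) :
    I.factDegree (g.fact I.ind σ) = g.degree I σ := by
  cases g <;> simp [Atom.fact, factDegree, Atom.degree, Term.value_eq_eval]

theorem FInterp.factDegree_le_bconcept (I : FInterp S) {B : BConcept S} {d : I.Dom}
    {f : Fact S I.Dom} (hf : f ∈ B.facts d) : I.factDegree f ≤ I.bconcept B d := by
  rcases B with A | Q
  · obtain rfl : f = _ := hf
    exact le_rfl
  · obtain ⟨e, rfl⟩ := hf
    rw [factDegree_fact]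
    exact le_iSup (I.brole Q d) e

theorem FInterp.exists_lt_factDegree (I : FInterp S) {B : BConcept S} {d : I.Dom}
    {β : unitInterval} (h : β < I.bconcept B d) : ∃ f ∈ B.facts d, β < I.factDegree f := by
  rcases B with A | Q
  · exact ⟨_, rfl, h⟩
  · obtain ⟨e, he⟩ := lt_iSup_iff.1 h
    exact ⟨_, ⟨e, rfl⟩, by rwa [factDegree_fact]⟩

theorem FInterp.closed_cut {I : FInterp S} {T : TBox S} (hI : ∀ ι ∈ T, I.SatInclusion ι)
    (β : unitInterval) : Closed T {f | β < I.factDegree f} where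
  concept hT h := by
    obtain ⟨f, hf, hfB⟩ := h
    obtain ⟨f', hfB', hf'⟩ := I.exists_lt_factDegree
      ((lt_of_lt_of_le hf (I.factDegree_le_bconcept hfB)).trans_le (hI _ hT _))
    exact ⟨f', hf', hfB'⟩
  role hT h := by
    simp only [Set.mem_ofPred_eq, factDegree_fact] at h ⊢
    exact h.trans_le (hI _ hT _ _)

theorem CQ.exists_matches_of_lt_degree {n : ℕ} {q : CQ S n} {I : FInterp S} {t : Fin n → Ind S}
    {β : unitInterval} (h : β < q.degree I t) :
    ∃ σ, q.Matches I.ind {f | β < I.factDegree f} t σ := by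
  rw [CQ.degree, lt_iSup_iff] at h
  obtain ⟨σ, h⟩ := h
  obtain ⟨hh, hb⟩ := lt_iSup_iff.1 h
  refine ⟨σ, fun i => by rw [Term.value_eq_eval, hh], fun g hg => ?_⟩
  rw [Set.mem_ofPred_eq, I.factDegree_atom]
  exact hb.trans_le (Finset.inf_le hg)

theorem CQ.Matches.le_degree {n : ℕ} {q : CQ S n} {I : FInterp S} {t : Fin n → Ind S}
    {β : unitInterval} {σ : ℕ → I.Dom} (h : q.Matches I.ind {f | β ≤ I.factDegree f} t σ) :
    β ≤ q.degree I t := by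
  refine le_iSup₂_of_le σ (fun i => by rw [← Term.value_eq_eval, h.head i]) ?_
  refine Finset.le_inf fun g hg => ?_
  rw [← I.factDegree_atom]
  exact h.body g hg

theorem CQ.Matches.mono {n : ℕ} {D : Type u} {q : CQ S n} {j : Ind S → D} {X Y : Set (Fact S D)}
    {t : Fin n → Ind S} {σ : ℕ → D} (h : q.Matches j X t σ) (hXY : X ⊆ Y) : q.Matches j Y t σ :=
  ⟨h.head, fun g hg => hXY (h.body g hg)⟩

theorem CQ.Matches.map {n : ℕ} {D E : Type u} {q : CQ S n} {j : Ind S → D} {X : Set (Fact S D)}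
    {Y : Set (Fact S E)} {t : Fin n → Ind S} {σ : ℕ → D} (h : q.Matches j X t σ) (k : D → E)
    (hk : ∀ f ∈ X, f.map k ∈ Y) : q.Matches (k ∘ j) Y t (k ∘ σ) := by
  have hval : ∀ s : Term S, s.value (k ∘ j) (k ∘ σ) = k (s.value j σ) := by
    rintro (x | a) <;> rfl
  refine ⟨fun i => by rw [hval, h.head i]; rfl, fun g hg => ?_⟩
  have := hk _ (h.body g hg)
  rcases g with ⟨A, s⟩ | ⟨r, s, s'⟩ <;> simpa only [Atom.fact, Fact.map, hval] using this

theorem FInterp.factDegree_abox_le {K : FAKB S} {I : FInterp S} (hI : I.IsModel K)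
    (f : Fact S (Ind S)) :
    FInterp.factDegree K.abox.interp f ≤ I.factDegree (f.map I.ind) := by
  rcases f with ⟨A, a⟩ | ⟨r, a, b⟩
  · exact sSup_le fun v hv => hI.2 _ hv
  · exact sSup_le fun v hv => hI.2 _ hv

/-- The reformulation evaluated over the ABox bounds the query from below in every model. -/
theorem CQ.degree_abox_le {n : ℕ} {K : FAKB S} {I : FInterp S} (hI : I.IsModel K) {q q' : CQ S n}
    (hr : Relation.ReflTransGen (Step K.tbox) q q') (t : Fin n → Ind S) :
    q'.degree K.abox.interp t ≤ q.degree I t := by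
  refine le_of_forall_lt_imp_le_of_dense fun β hβ => ?_
  obtain ⟨σ, hσ⟩ := CQ.exists_matches_of_lt_degree hβ
  have hσ' : q'.Matches I.ind {f | β < I.factDegree f} t (I.ind ∘ σ) :=
    hσ.map I.ind fun f hf => lt_of_lt_of_le hf (FInterp.factDegree_abox_le hI f)
  obtain ⟨τ, hτ⟩ := CQ.matches_of_reachable (FInterp.closed_cut hI.1 β) hr ⟨_, hσ'⟩
  exact (hτ.mono fun f (hf : β < I.factDegree f) => hf.le).le_degree

/-! ### The canonical model -/

/-- The facts over individuals whose degree in the ABox is at least `α`. -/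
def FABox.cut (A : FABox S) (α : unitInterval) : Set (Fact S (Elt S)) :=
  Fact.map Elt.ind '' {f : Fact S (Ind S) | α ≤ FInterp.factDegree A.interp f}

theorem FABox.nullFree_cut (A : FABox S) (α : unitInterval) : NullFree (A.cut α) := by
  rintro _ ⟨f, -, rfl⟩ z hz
  exact Fact.mentions_map hz

theorem FABox.cut_anti (A : FABox S) {α β : unitInterval} (h : β ≤ α) : A.cut α ⊆ A.cut β :=
  Set.image_mono fun _ hf => h.trans hf

/-- The facts derived from the assertions of degree at least `α`. -/
def FAKB.derived (K : FAKB S) (α : unitInterval) : Set (Fact S (Elt S)) :=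
  chase K.tbox (K.abox.cut α)

theorem FAKB.derived_anti (K : FAKB S) {α β : unitInterval} (h : β ≤ α) :
    K.derived α ⊆ K.derived β := chase_mono (K.abox.cut_anti h)

/-- The canonical interpretation: the degree of a fact is the supremum of the thresholds at which it
is derived. -/
noncomputable def FAKB.canonical (K : FAKB S) : FInterp S where
  Dom := Elt S
  nonempty := ⟨.ind (.arg 0)⟩
  ind := .ind
  ind_injective _ _ h := Elt.ind.inj h
  concept A d := sSup {α | Fact.concept A d ∈ K.derived α}
  role r d e := sSup {α | Fact.role r d e ∈ K.derived α}

theorem FAKB.factDegree_canonical (K : FAKB S) (f : Fact S (Elt S)) :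
    FInterp.factDegree K.canonical f = sSup {α | f ∈ K.derived α} := by
  cases f <;> rfl

theorem FAKB.exists_derived_of_lt {K : FAKB S} {f : Fact S (Elt S)} {β : unitInterval}
    (h : β < FInterp.factDegree K.canonical f) : ∃ α, β < α ∧ f ∈ K.derived α := by
  rw [factDegree_canonical, lt_sSup_iff] at h
  obtain ⟨α, hα, hβ⟩ := h
  exact ⟨α, hβ, hα⟩

theorem FAKB.le_factDegree {K : FAKB S} {f : Fact S (Elt S)} {α : unitInterval}
    (h : f ∈ K.derived α) : α ≤ FInterp.factDegree K.canonical f := by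
  rw [factDegree_canonical]
  exact le_sSup h

/-- Facts derived at thresholds `α` and `β` have images in any given model with degrees above any
smaller bounds, under maps that agree on the objects common to the two facts. -/
theorem FAKB.exists_common_hom {K : FAKB S} {I : FInterp S} (hI : I.IsModel K)
    {f g : Fact S (Elt S)} {α β α' β' : unitInterval} (hf : f ∈ K.derived α)
    (hg : g ∈ K.derived β) (hα : α' < α) (hβ : β' < β) :
    ∃ h k : Elt S → I.Dom, (∀ z, f.Mentions z → g.Mentions z → h z = k z) ∧
      α' < I.factDegree (f.map h) ∧ β' < I.factDegree (g.map k) := by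
  classical
  have d₀ : I.Dom := I.nonempty.some
  have hom : ∀ {γ γ'} {X : Set (Fact S (Elt S))}, γ' < γ →
      Chase K.tbox (K.abox.cut γ) X → ∃ h : Elt S → I.Dom, (∀ a, h (.ind a) = I.ind a) ∧
        ∀ f ∈ X, γ' < I.factDegree (f.map h) := by
    intro γ γ' X hγ hX
    refine hX.exists_hom (K.abox.nullFree_cut γ) (FInterp.closed_cut hI.1 γ')
      (fun z => match z with | .ind a => I.ind a | .wit _ _ => d₀) ?_
    rintro _ ⟨f, hf, rfl⟩
    rw [Fact.map_map]
    exact hγ.trans_le (le_trans hf (FInterp.factDegree_abox_le hI f))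
  by_cases hnull : ∃ x Q, f.Mentions (.wit x Q) ∧ g.Mentions (.wit x Q)
  · obtain ⟨x, Q, hfx, hgx⟩ := hnull
    -- a common null is created at both thresholds, so both facts are derived at the larger one
    have hc : ∀ {γ} {f : Fact S (Elt S)}, f.Mentions (.wit x Q) → f ∈ K.derived γ →
        Q.fact x (.wit x Q) ∈ K.derived γ := fun hm ⟨X, hX, hfX⟩ =>
      ⟨X, hX, hX.creation_mem (K.abox.nullFree_cut _) hfX hm⟩
    have hfβ := mem_chase_of_creation_mem (K.abox.nullFree_cut α) (hc hgx hg) hf hfx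
    have hgα := mem_chase_of_creation_mem (K.abox.nullFree_cut β) (hc hfx hf) hg hgx
    have hmax : f ∈ K.derived (max α β) ∧ g ∈ K.derived (max α β) := by
      rcases max_choice α β with h | h <;> rw [h]
      exacts [⟨hf, hgα⟩, ⟨hfβ, hg⟩]
    obtain ⟨⟨X, hX, hfX⟩, ⟨Y, hY, hgY⟩⟩ := hmax
    obtain ⟨h, -, hh⟩ := hom (max_lt_max hα hβ) (hX.union subset_rfl hY)
    exact ⟨h, h, fun _ _ _ => rfl, (le_max_left _ _).trans_lt (hh f (Or.inl hfX)),
      (le_max_right _ _).trans_lt (hh g (Or.inr hgY))⟩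
  · push Not at hnull
    obtain ⟨X, hX, hfX⟩ := hf
    obtain ⟨Y, hY, hgY⟩ := hg
    obtain ⟨h, hind, hh⟩ := hom hα hX
    obtain ⟨k, kind, hk⟩ := hom hβ hY
    refine ⟨h, k, ?_, hh f hfX, hk g hgY⟩
    rintro (a | ⟨x, Q⟩) h1 h2
    · rw [hind, kind]
    · exact absurd h2 (hnull x Q h1)

theorem le_symm_of_forall_lt {a b : unitInterval}
    (h : ∀ a' < a, ∀ b' < b, a' ≤ unitInterval.symm b') : a ≤ unitInterval.symm b := by
  refine le_of_forall_lt_imp_le_of_dense fun a' ha => ?_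
  rw [unitInterval.le_symm_comm]
  exact le_of_forall_lt_imp_le_of_dense fun b' hb => unitInterval.le_symm_comm.1 (h a' ha b' hb)

theorem FAKB.canonical_isModel {K : FAKB S} (hK : K.Consistent) : K.canonical.IsModel K := by
  obtain ⟨I, hI⟩ := hK
  have hcl : ∀ α, Closed K.tbox (K.derived α) := fun α => closed_chase _ _
  refine ⟨fun ι hι => ?_, fun φ hφ => ?_⟩
  · rcases ι with ⟨B, B'⟩ | ⟨B, B'⟩ | ⟨Q, Q'⟩ | ⟨Q, Q'⟩
    · refine fun d => le_of_forall_lt_imp_le_of_dense fun β hβ => ?_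
      obtain ⟨f, hfB, hf⟩ := K.canonical.exists_lt_factDegree hβ
      obtain ⟨α, hα, hfα⟩ := exists_derived_of_lt hf
      obtain ⟨f', hf', hfB'⟩ := (hcl α).concept hι ⟨f, hfα, hfB⟩
      exact hα.le.trans ((le_factDegree hf').trans (K.canonical.factDegree_le_bconcept hfB'))
    · refine fun d => le_symm_of_forall_lt fun a ha b hb => ?_
      obtain ⟨f, hfB, hf⟩ := K.canonical.exists_lt_factDegree ha
      obtain ⟨g, hgB, hg⟩ := K.canonical.exists_lt_factDegree hb
      obtain ⟨α, hα, hfα⟩ := exists_derived_of_lt hf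
      obtain ⟨β, hβ, hgβ⟩ := exists_derived_of_lt hg
      obtain ⟨h, k, hhk, h1, h2⟩ := exists_common_hom hI hfα hgβ hα hβ
      have hd : h d = k d := hhk d (BConcept.mentions_of_mem_facts hfB)
        (BConcept.mentions_of_mem_facts hgB)
      have h3 := h1.le.trans (I.factDegree_le_bconcept (BConcept.map_mem_facts h hfB))
      have h4 := h2.le.trans (I.factDegree_le_bconcept (BConcept.map_mem_facts k hgB))
      rw [← hd] at h4
      exact (h3.trans (hI.1 _ hι (h d))).trans (unitInterval.symm_le_symm.2 h4)
    · intro d e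
      rw [← FInterp.factDegree_fact, ← FInterp.factDegree_fact]
      refine le_of_forall_lt_imp_le_of_dense fun β hβ => ?_
      obtain ⟨α, hα, hfα⟩ := exists_derived_of_lt hβ
      exact hα.le.trans (le_factDegree ((hcl α).role hι hfα))
    · intro d e
      rw [← FInterp.factDegree_fact, ← FInterp.factDegree_fact]
      refine le_symm_of_forall_lt fun a ha b hb => ?_
      obtain ⟨α, hα, hfα⟩ := exists_derived_of_lt ha
      obtain ⟨β, hβ, hgβ⟩ := exists_derived_of_lt hb
      obtain ⟨h, k, hhk, h1, h2⟩ := exists_common_hom hI hfα hgβ hα hβ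
      have hd : h d = k d := hhk d ((BRole.mentions_fact _ _ _ _).2 (Or.inl rfl))
        ((BRole.mentions_fact _ _ _ _).2 (Or.inl rfl))
      have he : h e = k e := hhk e ((BRole.mentions_fact _ _ _ _).2 (Or.inr rfl))
        ((BRole.mentions_fact _ _ _ _).2 (Or.inr rfl))
      replace h1 := h1.trans_eq (congrArg I.factDegree (Q.map_fact h d e))
      replace h2 := h2.trans_eq (congrArg I.factDegree (Q'.map_fact k d e))
      rw [FInterp.factDegree_fact] at h1 h2
      rw [← hd, ← he] at h2
      exact (h1.le.trans (hI.1 _ hι (h d) (h e))).trans (unitInterval.symm_le_symm.2 h2.le)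
  · have hbase : ∀ (f : Fact S (Ind S)) (v : unitInterval),
        v ≤ FInterp.factDegree K.abox.interp f →
        v ≤ FInterp.factDegree K.canonical (f.map Elt.ind) := fun f v hv =>
      le_factDegree ⟨_, .base, f, hv, rfl⟩
    rcases φ with ⟨A, a, v⟩ | ⟨r, a, b, v⟩
    · exact hbase (.concept A a) v (le_sSup hφ)
    · exact hbase (.role r a b) v (le_sSup hφ)

/-- In the canonical model, no query exceeds its reformulation over the ABox. -/
theorem FAKB.degree_canonical_le {n : ℕ} (K : FAKB S) (q : CQ S n) (t : Fin n → Ind S) :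
    q.degree K.canonical t ≤ UCQ.degree (q.ref K.tbox) K.abox.interp t := by
  classical
  refine le_of_forall_lt_imp_le_of_dense fun β hβ => ?_
  obtain ⟨σ, hσ⟩ := CQ.exists_matches_of_lt_degree hβ
  have hbody : ∀ f ∈ q.body.image (Atom.fact Elt.ind σ), f ∈ K.derived β := by
    intro f hf
    obtain ⟨g, hg, rfl⟩ := Finset.mem_image.1 hf
    obtain ⟨α, hα, hgα⟩ := exists_derived_of_lt (hσ.body g hg)
    exact K.derived_anti hα.le hgα
  obtain ⟨X, hX, hXb⟩ := exists_chase_of_finset hbody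
  have hm : q.Matches Elt.ind X t σ :=
    ⟨hσ.head, fun g hg => hXb _ (Finset.mem_image_of_mem _ hg)⟩
  obtain ⟨q', τ, hr, hτ⟩ := hX.exists_rewriting (K.abox.nullFree_cut β) hm
  -- forget the nulls: they are values only of variables that do not occur in `q'`
  let p : Elt S → Ind S := fun z => match z with | .ind a => a | .wit _ _ => .arg 0
  have hp : q'.Matches (D := Ind S) id {f | β ≤ FInterp.factDegree K.abox.interp f} t (p ∘ τ) := by
    refine hτ.map p ?_
    rintro _ ⟨f, hf, rfl⟩
    rw [Fact.map_map]
    have : f.map (p ∘ Elt.ind) = f := by cases f <;> rfl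
    rwa [this]
  refine (CQ.Matches.le_degree (I := K.abox.interp) hp).trans ?_
  exact Finset.le_sup (f := fun q : CQ S n => q.degree K.abox.interp t)
    ((finite_reachable K.tbox q).mem_toFinset.2 hr)

theorem FAKB.iInf_degree_eq {n : ℕ} {K : FAKB S} (hK : K.Consistent) (Q : UCQ S n)
    (t : Fin n → Ind S) :
    ⨅ (I : FInterp S) (_ : I.IsModel K), UCQ.degree Q I t =
      UCQ.degree (ref Q K.tbox) K.abox.interp t := by
  classical
  apply le_antisymm
  · refine (iInf₂_le K.canonical (canonical_isModel hK)).trans (Finset.sup_le fun q hq => ?_)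
    refine (K.degree_canonical_le q t).trans (Finset.sup_mono ?_)
    exact Finset.subset_biUnion_of_mem (fun q : CQ S n => q.ref K.tbox) hq
  · refine le_iInf₂ fun I hI => Finset.sup_le fun q' hq' => ?_
    obtain ⟨q, hq, hr⟩ := Finset.mem_biUnion.1 hq'
    refine (CQ.degree_abox_le hI ((finite_reachable K.tbox q).mem_toFinset.1 hr) t).trans ?_
    exact Finset.le_sup (f := fun q : CQ S n => q.degree I t) hq

end FuzzyArg

theorem mainTheorem1 (S : FuzzyArg.Signature.{u}) (K : FuzzyArg.FAKB S) (hK : K.Consistent)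
    (n : ℕ) (Q : FuzzyArg.UCQ S n) (hQ : ∀ q ∈ Q, q.Safe) :
    FuzzyArg.fcert Q K = FuzzyArg.fans (FuzzyArg.ref Q K.tbox) K.abox := by
  ext ⟨t, α⟩
  simp only [FuzzyArg.fcert, FuzzyArg.fans, FuzzyArg.ans, Set.mem_ofPred_eq,
    FuzzyArg.FAKB.iInf_degree_eq hK]
  constructor
  · rintro ⟨rfl, h⟩
    exact ⟨h, rfl⟩
  · rintro ⟨h, rfl⟩
    exact ⟨rfl, h⟩
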